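/- The Cayley--Dickson algebras are $A_0=\mathbb{R}$ and $A_n=A_{n-1}\times A_{n-1}$ with conjugation $(a,b)^*=(a^*,-b)$ (trivial on $A_0$) and product $(a,b)(c,d)=(ac-d^*b,\ da+bc^*)$; so $A_3$ is the algebra of octonions and $A_4$ that of sedenions. Put $\mathrm{Re}(x)=\frac12(x+x^*)$, $\mathrm{Im}(x)=x-\mathrm{Re}(x)$, $\langle x,y\rangle=\mathrm{Re}(xy^*)$, $\|x\|=\sqrt{\langle x,x\rangle}$, $x\times y=\mathrm{Im}(xy^*)$, and call $x$ imaginary if $\mathrm{Re}(x)=0$. Let $\langle\langle a,b\rangle\rangle$ be the smallest real subspace containing $1,a,b$ that is closed under multiplication and conjugation. For $u\neq0$ in $A_n$, let $M_u(x)=\|u\|^{-2}\,u^*(ux)$; the eigenvalues and eigenspaces $\mathrm{Eig}_\lambda(u)$ of $u$ are those of the $\mathbb{R}$-linear map $M_u$. Let $\mathbb{C}_4\subset A_4$ be the real span of $1$ and $i_4=(0,1)$. **Theorem.** Let $a,b$ be linearly independent imaginary elements of $A_3$ with $\|a\|^2+\|b\|^2=1$. Then $(a,b)$ is a unit vector of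 $A_4$ and $a\times b\ne0$. Set $c=a\times b/\|a\times b\|$. Then 1. $\mathrm{Eig}_1(a,b)=\langle\langle a,b\rangle\rangle\times\langle\langle a,b\rangle\rangle$; 2. $\mathrm{Eig}_{1+2\|a\times b\|}(a,b)=\{(x,-cx): x\in\langle\langle a,b\rangle\rangle^\perp\}$; 3. $\mathrm{Eig}_{1-2\|a\times b\|}(a,b)=\{(x,cx): x\in\langle\langle a,b\rangle\rangle^\perp\}$; 4. $A_4$ is the direct sum of these three subspaces, and the eigenvalues of $(a,b)$ are exactly $1$, $1+2\|a\times b\|$ and $1-2\|a\times b\|$. Moreover, this gives the full eigentheory of the elements of $A_4$ orthogonal to $\mathbb{C}_4$: every non-zero $u\in\mathbb{C}_4^\perp$ can be written as $u=t\,(a,b)$ with $t>0$ real and $a,b\in A_3$ imaginary such that $\|a\|^2+\|b\|^2=1$ and $M_u=M_{(a,b)}$, and if $a,b$ are linearly dependent, then $M_u$ is the identity. -/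

import Mathlib

/-- The underlying space of the Cayley-Dickson algebra `A_n`: `A_0 = ℝ` and
`A_{n+1} = A_n × A_n`. -/
def CD : ℕ → Type
  | 0 => ℝ
  | n + 1 => CD n × CD n

namespace CD

/-- The element `(a, b)` of `A_{n+1}`. -/
def pair {n : ℕ} (a b : CD n) : CD (n + 1) := ((a, b) : CD n × CD n)

/-- First component of an element of `A_{n+1}`. -/
def fst {n : ℕ} (x : CD (n + 1)) : CD n := Prod.fst (α := CD n) (β := CD n) x

/-- Second component of an element of `A_{n+1}`. -/
def snd {n : ℕ} (x : CD (n + 1)) : CD n := Prod.snd (α := CD n) (β := CD n) x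

@[simp] theorem fst_pair {n : ℕ} (a b : CD n) : (pair a b).fst = a := rfl
@[simp] theorem snd_pair {n : ℕ} (a b : CD n) : (pair a b).snd = b := rfl
@[simp] theorem pair_eta {n : ℕ} (x : CD (n + 1)) : pair x.fst x.snd = x := rfl

theorem ext {n : ℕ} {x y : CD (n + 1)} (h₁ : x.fst = y.fst) (h₂ : x.snd = y.snd) : x = y :=
  Prod.ext h₁ h₂

/-! Additive and linear structure (componentwise). -/

noncomputable instance instAddCommGroup : (n : ℕ) → AddCommGroup (CD n)
  | 0 => inferInstanceAs (AddCommGroup ℝ)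
  | n + 1 =>
    letI := instAddCommGroup n
    inferInstanceAs (AddCommGroup (CD n × CD n))

noncomputable instance instModule : (n : ℕ) → Module ℝ (CD n)
  | 0 => inferInstanceAs (Module ℝ ℝ)
  | n + 1 =>
    letI := instModule n
    inferInstanceAs (Module ℝ (CD n × CD n))

@[simp] theorem fst_zero {n : ℕ} : (0 : CD (n + 1)).fst = 0 := rfl
@[simp] theorem snd_zero {n : ℕ} : (0 : CD (n + 1)).snd = 0 := rfl
@[simp] theorem fst_add {n : ℕ} (x y : CD (n + 1)) : (x + y).fst = x.fst + y.fst := rfl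
@[simp] theorem snd_add {n : ℕ} (x y : CD (n + 1)) : (x + y).snd = x.snd + y.snd := rfl
@[simp] theorem fst_smul {n : ℕ} (r : ℝ) (x : CD (n + 1)) : (r • x).fst = r • x.fst := rfl
@[simp] theorem snd_smul {n : ℕ} (r : ℝ) (x : CD (n + 1)) : (r • x).snd = r • x.snd := rfl

/-- Conjugation: trivial on `A_0 = ℝ`, and `(a, b)^* = (a^*, -b)`. -/
noncomputable def conj : (n : ℕ) → CD n → CD n
  | 0, x => x
  | n + 1, x => pair (conj n (fst x)) (-(snd x))

/-- Multiplication: that of `ℝ` on `A_0`, and `(a, b)(c, d) = (ac - d^* b, da + b c^*)`. -/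
noncomputable def mul : (n : ℕ) → CD n → CD n → CD n
  | 0, x, y => Mul.mul (α := ℝ) x y
  | n + 1, x, y =>
    pair (mul n (fst x) (fst y) - mul n (conj n (snd y)) (snd x))
      (mul n (snd y) (fst x) + mul n (snd x) (conj n (fst y)))

/-- The unit `1 = (1, 0)`. -/
noncomputable def one : (n : ℕ) → CD n
  | 0 => (1 : ℝ)
  | n + 1 => pair (one n) 0

theorem conj_add' : (n : ℕ) → (x y : CD n) → conj n (x + y) = conj n x + conj n y
  | 0, _, _ => rfl
  | n + 1, x, y => ext (conj_add' n x.fst y.fst) (neg_add (snd x) (snd y))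

theorem conj_smul' : (n : ℕ) → (r : ℝ) → (x : CD n) → conj n (r • x) = r • conj n x
  | 0, _, _ => rfl
  | n + 1, r, x => ext (conj_smul' n r x.fst) (smul_neg r (snd x)).symm

theorem conj_zero' (n : ℕ) : conj n 0 = 0 := by
  simpa using conj_smul' n 0 0

theorem conj_neg' (n : ℕ) (x : CD n) : conj n (-x) = -conj n x := by
  simpa using conj_smul' n (-1) x

theorem conj_sub' (n : ℕ) (x y : CD n) : conj n (x - y) = conj n x - conj n y := by
  rw [sub_eq_add_neg, conj_add', conj_neg', sub_eq_add_neg]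

theorem conj_conj' : (n : ℕ) → (x : CD n) → conj n (conj n x) = x
  | 0, _ => rfl
  | n + 1, x => ext (conj_conj' n x.fst) (neg_neg (snd x))

theorem mul_add' : (n : ℕ) → (x y z : CD n) → mul n x (y + z) = mul n x y + mul n x z
  | 0, x, y, z => left_distrib (R := ℝ) x y z
  | n + 1, x, y, z => by
    have add_mul' : ∀ x y z : CD n, mul n (x + y) z = mul n x z + mul n y z := add_mul_aux n
    apply ext
    · simp only [mul, fst_pair, fst_add, snd_add, conj_add', mul_add' n, add_mul']
      abel
    · simp only [mul, snd_pair, fst_add, snd_add, conj_add', mul_add' n, add_mul']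
      abel
where
  add_mul_aux : (n : ℕ) → (x y z : CD n) → mul n (x + y) z = mul n x z + mul n y z
  | 0, x, y, z => right_distrib (R := ℝ) x y z
  | n + 1, x, y, z => by
    apply ext
    · simp only [mul, fst_pair, fst_add, snd_add, mul_add' n, add_mul_aux n]
      abel
    · simp only [mul, snd_pair, fst_add, snd_add, mul_add' n, add_mul_aux n]
      abel

theorem add_mul' (n : ℕ) (x y z : CD n) : mul n (x + y) z = mul n x z + mul n y z :=
  mul_add'.add_mul_aux n x y z

theorem mul_smul_smul' : (n : ℕ) → (r : ℝ) → (x y : CD n) →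
    mul n (r • x) y = r • mul n x y ∧ mul n x (r • y) = r • mul n x y
  | 0, r, x, y => ⟨mul_assoc (G := ℝ) r x y, mul_left_comm (G := ℝ) x r y⟩
  | n + 1, r, x, y => by
    have h₁ : ∀ x y : CD n, mul n (r • x) y = r • mul n x y :=
      fun x y => (mul_smul_smul' n r x y).1
    have h₂ : ∀ x y : CD n, mul n x (r • y) = r • mul n x y :=
      fun x y => (mul_smul_smul' n r x y).2
    constructor <;> apply ext <;>
      simp only [mul, fst_pair, snd_pair, fst_smul, snd_smul, conj_smul', h₁, h₂, smul_add,
        smul_sub]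

theorem mul_zero' (n : ℕ) (x : CD n) : mul n x 0 = 0 := by
  simpa using (mul_smul_smul' n 0 x 0).2

theorem zero_mul' (n : ℕ) (x : CD n) : mul n 0 x = 0 := by
  simpa using (mul_smul_smul' n 0 0 x).1

theorem conj_one' : (n : ℕ) → conj n (one n) = one n
  | 0 => rfl
  | n + 1 => ext (conj_one' n) (neg_zero (G := CD n))

theorem mul_one_one' : (n : ℕ) → (x : CD n) → mul n x (one n) = x ∧ mul n (one n) x = x
  | 0, x => ⟨mul_one (M := ℝ) x, one_mul (M := ℝ) x⟩
  | n + 1, x => by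
    have h₁ : ∀ x : CD n, mul n x (one n) = x := fun x => (mul_one_one' n x).1
    have h₂ : ∀ x : CD n, mul n (one n) x = x := fun x => (mul_one_one' n x).2
    constructor <;> apply ext <;>
      simp [mul, one, conj_zero', conj_one', mul_zero', zero_mul', h₁, h₂]

theorem neg_mul_mul_neg' (n : ℕ) (x y : CD n) :
    mul n (-x) y = -mul n x y ∧ mul n x (-y) = -mul n x y := by
  simpa using mul_smul_smul' n (-1) x y

theorem conj_mul' : (n : ℕ) → (x y : CD n) → conj n (mul n x y) = mul n (conj n y) (conj n x)
  | 0, x, y => mul_comm (G := ℝ) x y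
  | n + 1, x, y => by
    have h₁ : ∀ x y : CD n, mul n (-x) y = -mul n x y := fun x y => (neg_mul_mul_neg' n x y).1
    have h₂ : ∀ x y : CD n, mul n x (-y) = -mul n x y := fun x y => (neg_mul_mul_neg' n x y).2
    apply ext
    · simp [mul, conj, conj_sub', conj_mul' n, conj_conj', conj_neg', h₁, h₂]
    · simp [mul, conj, conj_conj', h₁, add_comm]

/-- `A_n` is a (unital, non-associative) ring. -/
noncomputable instance instNonAssocRing (n : ℕ) : NonAssocRing (CD n) :=
  { instAddCommGroup n with
    mul := mul n
    one := one n
    left_distrib := mul_add' n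
    right_distrib := add_mul' n
    zero_mul := zero_mul' n
    mul_zero := mul_zero' n
    one_mul := fun x => (mul_one_one' n x).2
    mul_one := fun x => (mul_one_one' n x).1 }

instance instIsScalarTower (n : ℕ) : IsScalarTower ℝ (CD n) (CD n) :=
  ⟨fun r x y => (mul_smul_smul' n r x y).1⟩

instance instSMulCommClass (n : ℕ) : SMulCommClass ℝ (CD n) (CD n) :=
  ⟨fun r x y => ((mul_smul_smul' n r x y).2).symm⟩

/-- `star x` is the conjugate `x^*`. -/
noncomputable instance instStarRing (n : ℕ) : StarRing (CD n) where
  star := conj n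
  star_involutive := conj_conj' n
  star_mul := conj_mul' n
  star_add := conj_add' n

@[simp] theorem fst_neg {n : ℕ} (x : CD (n + 1)) : (-x).fst = -x.fst := rfl
@[simp] theorem snd_neg {n : ℕ} (x : CD (n + 1)) : (-x).snd = -x.snd := rfl
@[simp] theorem fst_one {n : ℕ} : (1 : CD (n + 1)).fst = 1 := rfl
@[simp] theorem snd_one {n : ℕ} : (1 : CD (n + 1)).snd = 0 := rfl
@[simp] theorem fst_star {n : ℕ} (x : CD (n + 1)) : (star x).fst = star x.fst := rfl
@[simp] theorem snd_star {n : ℕ} (x : CD (n + 1)) : (star x).snd = -x.snd := rfl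
@[simp] theorem fst_mul {n : ℕ} (x y : CD (n + 1)) :
    (x * y).fst = x.fst * y.fst - star y.snd * x.snd := rfl
@[simp] theorem snd_mul {n : ℕ} (x y : CD (n + 1)) :
    (x * y).snd = y.snd * x.fst + x.snd * star y.fst := rfl

/-! Real and imaginary parts. -/

/-- `Re x = (x + x^*) / 2`, an element of `A_n`. -/
noncomputable def rePart {n : ℕ} (x : CD n) : CD n := (1 / 2 : ℝ) • (x + star x)

/-- `Im x = x - Re x`. -/
noncomputable def imPart {n : ℕ} (x : CD n) : CD n := x - rePart x

/-- `x` is imaginary if its real part vanishes. -/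
def IsImaginary {n : ℕ} (x : CD n) : Prop := rePart x = 0

/-- `Re x` as a real number, see `rePart_eq`. -/
noncomputable def reCoord : (n : ℕ) → CD n → ℝ
  | 0, x => x
  | n + 1, x => reCoord n (fst x)

/-- `Re x` is the real number `reCoord x`, seen in `A_n` as a multiple of `1`. -/
theorem rePart_eq : (n : ℕ) → (x : CD n) → rePart x = reCoord n x • (1 : CD n)
  | 0, x => by
    have h : ∀ r : ℝ, (1 / 2 : ℝ) * (r + r) = r * 1 := fun r => by ring
    exact h x
  | n + 1, x => by
    apply ext
    · exact rePart_eq n x.fst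
    · simp [rePart]

theorem reCoord_add : (n : ℕ) → (x y : CD n) → reCoord n (x + y) = reCoord n x + reCoord n y
  | 0, _, _ => rfl
  | n + 1, x, y => reCoord_add n x.fst y.fst

theorem reCoord_smul : (n : ℕ) → (r : ℝ) → (x : CD n) → reCoord n (r • x) = r * reCoord n x
  | 0, _, _ => rfl
  | n + 1, r, x => reCoord_smul n r x.fst

theorem reCoord_neg (n : ℕ) (x : CD n) : reCoord n (-x) = -reCoord n x := by
  simpa using reCoord_smul n (-1) x

theorem reCoord_star : (n : ℕ) → (x : CD n) → reCoord n (star x) = reCoord n x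
  | 0, _ => rfl
  | n + 1, x => reCoord_star n x.fst

theorem reCoord_mul_comm : (n : ℕ) → (x y : CD n) → reCoord n (x * y) = reCoord n (y * x)
  | 0, x, y => mul_comm (G := ℝ) x y
  | n + 1, x, y => by
    have h : reCoord n (star y.snd * x.snd) = reCoord n (star x.snd * y.snd) := by
      rw [← reCoord_star, star_mul, star_star]
    simp only [reCoord, fst_mul, sub_eq_add_neg, reCoord_add, reCoord_neg, h,
      reCoord_mul_comm n x.fst]

/-- The real inner product `Re (x y^*)` is the componentwise one. -/
theorem reCoord_mul_star (n : ℕ) (x y : CD (n + 1)) :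
    reCoord (n + 1) (x * star y) =
      reCoord n (x.fst * star y.fst) + reCoord n (x.snd * star y.snd) := by
  simp only [reCoord, fst_mul, fst_star, snd_star, star_neg, neg_mul, sub_neg_eq_add, reCoord_add]
  rw [reCoord_mul_comm n (star y.snd)]

theorem reCoord_self_nonneg : (n : ℕ) → (x : CD n) → 0 ≤ reCoord n (x * star x)
  | 0, x => mul_self_nonneg (R := ℝ) x
  | n + 1, x => by
    rw [reCoord_mul_star]
    exact add_nonneg (reCoord_self_nonneg n _) (reCoord_self_nonneg n _)

theorem reCoord_self_definite : (n : ℕ) → (x : CD n) → reCoord n (x * star x) = 0 → x = 0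
  | 0, x, h => (mul_self_eq_zero (M₀ := ℝ)).1 h
  | n + 1, x, h => by
    rw [reCoord_mul_star] at h
    have h₁ := reCoord_self_nonneg n x.fst
    have h₂ := reCoord_self_nonneg n x.snd
    exact ext (reCoord_self_definite n _ (by linarith)) (reCoord_self_definite n _ (by linarith))

/-- The real inner product `⟨x, y⟩ = Re (x y^*)`. -/
@[reducible]
noncomputable def innerCore (n : ℕ) : InnerProductSpace.Core ℝ (CD n) where
  inner x y := reCoord n (x * star y)
  conj_inner_symm x y := by
    change reCoord n (y * star x) = reCoord n (x * star y)
    rw [← reCoord_star, star_mul, star_star]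
  re_inner_nonneg x := reCoord_self_nonneg n x
  add_left x y z := by
    change reCoord n ((x + y) * star z) = _
    rw [add_mul, reCoord_add]
  smul_left x y r := by
    change reCoord n ((r • x) * star y) = r * reCoord n (x * star y)
    rw [smul_mul_assoc, reCoord_smul]
  definite x h := reCoord_self_definite n x h

/-- The norm `‖x‖ = √⟨x, x⟩`. -/
noncomputable instance instNormedAddCommGroup (n : ℕ) : NormedAddCommGroup (CD n) :=
  (innerCore n).toNormedAddCommGroup

noncomputable instance instInnerProductSpace (n : ℕ) : InnerProductSpace ℝ (CD n) :=
  InnerProductSpace.ofCore (innerCore n).toCore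

theorem inner_def {n : ℕ} (x y : CD n) : inner ℝ x y = reCoord n (x * star y) := rfl

/-! Notions built on the algebra structure. -/

/-- The cross-product `a × b = Im (a b^*)`. -/
noncomputable def cross {n : ℕ} (a b : CD n) : CD n := imPart (a * star b)

/-- The distinguished element `i_{n+1} = (0, 1)` of `A_{n+1}`. -/
noncomputable def iElt (n : ℕ) : CD (n + 1) := pair 0 1

/-- The subspace `ℂ_{n+1}` of `A_{n+1}`, the real span of `1` and `i_{n+1}`. -/
noncomputable def complexLine (n : ℕ) : Submodule ℝ (CD (n + 1)) := Submodule.span ℝ {1, iElt n}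

/-- A subalgebra is a linear subspace containing `1` and closed under multiplication and
conjugation. -/
structure IsSubalg {n : ℕ} (S : Submodule ℝ (CD n)) : Prop where
  one_mem : (1 : CD n) ∈ S
  mul_mem : ∀ x ∈ S, ∀ y ∈ S, x * y ∈ S
  star_mem : ∀ x ∈ S, star x ∈ S

/-- `⟨⟨s⟩⟩`: the smallest subalgebra containing the set `s`. -/
noncomputable def generated {n : ℕ} (s : Set (CD n)) : Submodule ℝ (CD n) :=
  sInf {S | IsSubalg S ∧ s ⊆ S}

theorem isSubalg_generated {n : ℕ} (s : Set (CD n)) : IsSubalg (generated s) := by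
  constructor
  · exact (Submodule.mem_sInf).2 fun S hS => hS.1.one_mem
  · intro x hx y hy
    exact (Submodule.mem_sInf).2 fun S hS =>
      hS.1.mul_mem x ((Submodule.mem_sInf).1 hx S hS) y ((Submodule.mem_sInf).1 hy S hS)
  · intro x hx
    exact (Submodule.mem_sInf).2 fun S hS => hS.1.star_mem x ((Submodule.mem_sInf).1 hx S hS)

/-- The operator `M_a = ‖a‖⁻² L_{a^*} L_a` (for `a ≠ 0`). -/
noncomputable def M {n : ℕ} (a : CD n) : Module.End ℝ (CD n) :=
  (1 / ‖a‖ ^ 2) • (LinearMap.mulLeft ℝ (star a) ∘ₗ LinearMap.mulLeft ℝ a)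

/-- `Eig_r(a)`, the `r`-eigenspace of `M_a`. -/
noncomputable def Eig {n : ℕ} (r : ℝ) (a : CD n) : Submodule ℝ (CD n) :=
  Module.End.eigenspace (M a) r

end CD

/-!
For `u = (a, b)` in `A_{n+1}` with `A_n` alternative, the defect of `u^* (u z) = ‖u‖² z` is given by
the map `D x = (a x) b - a (x b)` of `A_n`: one has
`u^* (u (x, y)) = ‖u‖² (x, y) + (D y, -D x)`. If `A_n` is associative, `D` vanishes and `A_{n+1}` is
alternative; this applies to the octonions.

Let `a`, `b` be imaginary and let `S = ⟨⟨a, b⟩⟩`, which is spanned by `1, a, b, ab`. Then `D`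
vanishes on `S`, and on `Sᗮ` it is left multiplication by `2 (a × b)`, because `p (q x) = (q p) x`
for `p, q ∈ S` and `x ∈ Sᗮ`. Since left multiplication by the imaginary unit `c` squares to `-1`,
the operator `M_u` is a scalar on `S × S` and on the graphs of `x ↦ -c x` and `x ↦ c x` over `Sᗮ`.
These three subspaces span `A_{n+1}`, and eigenspaces are independent, so they are the full
eigenspaces and there is no further eigenvalue.
-/

/-- A not necessarily associative ring is alternative if `(x x) y = x (x y)` and
`(x y) y = x (y y)` for all `x`, `y`; both laws are expressed by the associator. -/
class IsAlternative (R : Type*) [NonUnitalNonAssocRing R] : Prop where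
  associator_self_left : ∀ x y : R, associator x x y = 0
  associator_self_right : ∀ x y : R, associator x y y = 0

namespace IsAlternative

variable {R : Type*} [NonUnitalNonAssocRing R]

theorem of_mul_assoc (h : ∀ x y z : R, x * y * z = x * (y * z)) : IsAlternative R where
  associator_self_left x y := sub_eq_zero.2 (h x x y)
  associator_self_right x y := sub_eq_zero.2 (h x y y)

variable [IsAlternative R]

theorem mul_self_mul (x y : R) : x * x * y = x * (x * y) :=
  sub_eq_zero.1 (associator_self_left x y)

theorem mul_mul_self (x y : R) : x * y * y = x * (y * y) :=
  sub_eq_zero.1 (associator_self_right x y)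

theorem associator_swap_left (x y z : R) : associator x y z = -associator y x z := by
  have expand : associator (x + y) (x + y) z =
      associator x x z + associator y y z + (associator x y z + associator y x z) := by
    simp only [associator, add_mul, mul_add]
    abel
  simpa only [associator_self_left, zero_add, eq_comm (a := (0 : R)), add_eq_zero_iff_eq_neg]
    using expand

theorem associator_swap_right (x y z : R) : associator x y z = -associator x z y := by
  have expand : associator x (y + z) (y + z) =
      associator x y y + associator x z z + (associator x y z + associator x z y) := by
    simp only [associator, add_mul, mul_add]
    abel
  simpa only [associator_self_right, zero_add, eq_comm (a := (0 : R)), add_eq_zero_iff_eq_neg]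
    using expand

theorem associator_swap_outer (x y z : R) : associator x y z = -associator z y x := by
  rw [associator_swap_left, associator_swap_right, associator_swap_left, neg_neg]

theorem associator_flexible (x y : R) : associator x y x = 0 := by
  rw [associator_swap_right, associator_self_left, neg_zero]

end IsAlternative

namespace CD

open IsAlternative

variable {n : ℕ}

theorem star_eq_two_smul_sub (x : CD n) : star x = (2 * reCoord n x) • (1 : CD n) - x := by
  rw [mul_smul, ← rePart_eq, rePart, smul_smul, mul_one_div_cancel two_ne_zero, one_smul,
    add_sub_cancel_left]

theorem star_smul_real (r : ℝ) (x : CD n) : star (r • x) = r • star x :=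
  conj_smul' n r x

theorem reCoord_sub (x y : CD n) : reCoord n (x - y) = reCoord n x - reCoord n y := by
  rw [sub_eq_add_neg, reCoord_add, reCoord_neg, sub_eq_add_neg]

theorem reCoord_one : (n : ℕ) → reCoord n (1 : CD n) = 1
  | 0 => rfl
  | n + 1 => reCoord_one n

theorem reCoord_zero (n : ℕ) : reCoord n (0 : CD n) = 0 := by
  rw [← zero_smul ℝ (0 : CD n), reCoord_smul, zero_mul]

instance instNontrivial (n : ℕ) : Nontrivial (CD n) where
  exists_pair_ne := ⟨1, 0, fun h => one_ne_zero (α := ℝ) <| by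
    rw [← reCoord_one n, h, reCoord_zero]⟩

theorem isImaginary_iff_reCoord_eq_zero {x : CD n} : x.IsImaginary ↔ reCoord n x = 0 := by
  rw [IsImaginary, rePart_eq, smul_eq_zero_iff_left one_ne_zero]

theorem isImaginary_iff_inner_one {x : CD n} : x.IsImaginary ↔ inner ℝ 1 x = 0 := by
  rw [isImaginary_iff_reCoord_eq_zero, inner_def, one_mul, reCoord_star]

theorem IsImaginary.smul {x : CD n} (hx : x.IsImaginary) (r : ℝ) : (r • x).IsImaginary := by
  rw [isImaginary_iff_inner_one] at hx ⊢
  rw [inner_smul_right, hx, mul_zero]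

theorem IsImaginary.star_eq_neg {x : CD n} (hx : x.IsImaginary) : star x = -x := by
  rw [star_eq_two_smul_sub, isImaginary_iff_reCoord_eq_zero.1 hx, mul_zero, zero_smul ℝ (1 : CD n),
    zero_sub]

/-! ### Norm and inner product -/

theorem mul_star_add_mul_star (x y : CD n) :
    x * star y + y * star x = (2 * inner ℝ x y : ℝ) • (1 : CD n) := by
  have h := star_eq_two_smul_sub (x * star y)
  rw [star_mul, star_star] at h
  rw [h, inner_def, add_sub_cancel]

theorem mul_star_self (x : CD n) : x * star x = ‖x‖ ^ 2 • (1 : CD n) := by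
  have h := mul_star_add_mul_star x x
  rw [← two_smul ℝ, mul_smul, real_inner_self_eq_norm_sq] at h
  exact smul_right_injective _ (two_ne_zero' ℝ) h

theorem star_mul_self (x : CD n) : star x * x = ‖x‖ ^ 2 • (1 : CD n) := by
  rw [← mul_star_self, star_eq_two_smul_sub, mul_sub, sub_mul, smul_one_mul, mul_smul_one]

theorem pair_zero_zero : pair (0 : CD n) 0 = 0 := rfl

theorem norm_sq_eq_add (x : CD (n + 1)) : ‖x‖ ^ 2 = ‖x.fst‖ ^ 2 + ‖x.snd‖ ^ 2 := by
  simp only [← real_inner_self_eq_norm_sq, inner_def, reCoord_mul_star]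

theorem norm_pair_eq_one {a b : CD n} (h : ‖a‖ ^ 2 + ‖b‖ ^ 2 = 1) : ‖pair a b‖ = 1 := by
  rw [← sq_eq_sq₀ (norm_nonneg _) zero_le_one, norm_sq_eq_add, fst_pair, snd_pair, h, one_pow]

theorem reCoord_mul_assoc : (n : ℕ) → (x y z : CD n) →
    reCoord n (x * y * z) = reCoord n (x * (y * z))
  | 0, x, y, z => mul_assoc (G := ℝ) x y z
  | n + 1, x, y, z => by
    have cycle (p q r : CD n) : reCoord n (p * (q * r)) = reCoord n (q * (r * p)) := by
      rw [reCoord_mul_comm, reCoord_mul_assoc n]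
    simp only [reCoord, fst_mul, snd_mul, sub_mul, mul_sub, mul_add, add_mul, star_add, star_mul,
      star_star, reCoord_sub, reCoord_add, reCoord_mul_assoc n]
    rw [cycle (star z.snd) y.snd, cycle y.snd x.fst, cycle (star y.snd) x.snd,
      cycle x.snd z.fst, cycle (star z.snd) x.snd, cycle x.snd (star y.fst)]
    ring

theorem inner_mul_left_eq (a x y : CD n) : inner ℝ (a * x) y = inner ℝ x (star a * y) := by
  simp only [inner_def, star_mul, star_star]
  rw [reCoord_mul_assoc, reCoord_mul_comm, reCoord_mul_assoc]

/-! ### Alternativity -/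

theorem associator_star_left (x y z : CD n) : associator (star x) y z = -associator x y z := by
  simp only [associator, star_eq_two_smul_sub x, sub_mul, smul_mul_assoc, one_mul]
  abel

theorem associator_star_mid (x y z : CD n) : associator x (star y) z = -associator x y z := by
  simp only [associator, star_eq_two_smul_sub y, sub_mul, mul_sub, smul_mul_assoc, mul_smul_comm,
    one_mul, mul_one]
  abel

theorem associator_star_right (x y z : CD n) : associator x y (star z) = -associator x y z := by
  simp only [associator, star_eq_two_smul_sub z, mul_sub, mul_smul_comm, mul_one]
  abel

section Alternative

variable [IsAlternative (CD n)]

theorem star_mul_mul (x y : CD n) : star x * (x * y) = ‖x‖ ^ 2 • y := by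
  have h := associator_star_left x x y
  rw [associator_self_left, neg_zero, associator, star_mul_self, smul_one_mul] at h
  exact (sub_eq_zero.1 h).symm

theorem mul_star_mul (x y : CD n) : x * (star x * y) = ‖x‖ ^ 2 • y := by
  have h := associator_star_mid x x y
  rw [associator_self_left, neg_zero, associator, mul_star_self, smul_one_mul] at h
  exact (sub_eq_zero.1 h).symm

theorem mul_mul_star (x y : CD n) : x * y * star y = ‖y‖ ^ 2 • x := by
  have h := associator_star_right x y y
  rw [associator_self_right, neg_zero, associator, mul_star_self, mul_smul_one] at h
  exact sub_eq_zero.1 h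

theorem mul_star_mul_self (x y : CD n) : x * star y * y = ‖y‖ ^ 2 • x := by
  have h := associator_star_mid x y y
  rw [associator_self_right, neg_zero, associator, star_mul_self, mul_smul_one] at h
  exact sub_eq_zero.1 h

theorem star_mul_mul_succ (u z : CD (n + 1)) :
    star u * (u * z) = ‖u‖ ^ 2 • z +
      pair (associator u.fst z.snd u.snd) (-associator u.fst z.fst u.snd) := by
  rw [norm_sq_eq_add, add_smul]
  apply ext
  · have h : associator (star u.fst) (star z.snd) u.snd = associator u.fst z.snd u.snd := by
      rw [associator_star_left, associator_star_mid, neg_neg]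
    rw [fst_add, fst_pair, ← h]
    simp only [fst_mul, snd_mul, fst_star, snd_star, fst_add, fst_smul, mul_sub, add_mul, star_add,
      star_mul, star_star, mul_neg, star_mul_mul, mul_star_mul_self, associator]
    abel
  · have h : associator u.snd (star z.fst) (star u.fst) = -associator u.fst z.fst u.snd := by
      rw [associator_star_right, associator_star_mid, neg_neg, associator_swap_outer]
    rw [snd_add, snd_pair, ← h]
    simp only [fst_mul, snd_mul, fst_star, snd_star, snd_add, snd_smul, mul_sub, add_mul, star_sub,
      star_mul, star_star, neg_mul, mul_mul_star, mul_star_mul, associator]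
    abel

end Alternative

theorem mul_comm_succ (hstar : ∀ x : CD n, star x = x) (hcomm : ∀ x y : CD n, x * y = y * x)
    (x y : CD (n + 1)) : x * y = y * x := by
  apply ext
  · rw [fst_mul, fst_mul, hstar, hstar, hcomm x.fst, hcomm x.snd]
  · rw [snd_mul, snd_mul, hstar, hstar, add_comm]

theorem mul_assoc_succ (hcomm : ∀ x y : CD n, x * y = y * x)
    (hassoc : ∀ x y z : CD n, x * y * z = x * (y * z)) (x y z : CD (n + 1)) :
    x * y * z = x * (y * z) := by
  have hleft (x y z : CD n) : x * (y * z) = y * (x * z) := by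
    rw [← hassoc, hcomm x, hassoc]
  apply ext <;>
  · simp only [fst_mul, snd_mul, mul_sub, add_mul, mul_add, star_add, star_sub, star_mul, star_star,
      hassoc, hcomm, hleft]
    abel

theorem isAlternative_succ (hassoc : ∀ x y z : CD n, x * y * z = x * (y * z)) :
    IsAlternative (CD (n + 1)) := by
  have : IsAlternative (CD n) := .of_mul_assoc hassoc
  have left (x y : CD (n + 1)) : associator x x y = 0 := by
    have hpair : star x * (x * y) = ‖x‖ ^ 2 • y := by
      rw [star_mul_mul_succ, associator, associator, hassoc, hassoc, sub_self, sub_self, neg_zero]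
      exact add_zero _
    rw [← neg_neg (associator x x y), ← associator_star_left, associator, star_mul_self,
      smul_one_mul, hpair, sub_self, neg_zero]
  have star_associator (x y z : CD (n + 1)) :
      star (associator x y z) = -associator (star z) (star y) (star x) := by
    simp only [associator, star_sub, star_mul, neg_sub]
  exact ⟨left, fun x y => star_injective <| by rw [star_associator, left, neg_zero, star_zero]⟩

theorem mul_assoc_quaternion : ∀ x y z : CD 2, x * y * z = x * (y * z) :=
  have real_comm : ∀ x y : CD 0, x * y = y * x := mul_comm (G := ℝ)
  mul_assoc_succ (mul_comm_succ (fun _ => rfl) real_comm)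
    (mul_assoc_succ real_comm (mul_assoc (G := ℝ)))

instance isAlternative_octonion : IsAlternative (CD 3) :=
  isAlternative_succ mul_assoc_quaternion

/-! ### Cross products -/

theorem isImaginary_cross (a b : CD n) : (cross a b).IsImaginary := by
  rw [isImaginary_iff_reCoord_eq_zero, cross, imPart, rePart_eq, reCoord_sub, reCoord_smul,
    reCoord_one, mul_one, sub_self]

theorem mul_star_eq_inner_add_cross (a b : CD n) :
    a * star b = (inner ℝ a b : ℝ) • (1 : CD n) + cross a b := by
  rw [cross, imPart, rePart_eq, inner_def, add_sub_cancel]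

theorem two_smul_cross {a b : CD n} (ha : a.IsImaginary) (hb : b.IsImaginary) :
    (2 : ℝ) • cross a b = b * a - a * b := by
  rw [cross, imPart, rePart, smul_sub, smul_smul, star_mul, star_star, ha.star_eq_neg,
    hb.star_eq_neg, mul_one_div_cancel two_ne_zero, one_smul, two_smul, mul_neg, mul_neg]
  abel

theorem cross_ne_zero [IsAlternative (CD n)] {a b : CD n} (hab : LinearIndependent ℝ ![a, b]) :
    cross a b ≠ 0 := by
  intro h
  have hdep : ‖b‖ ^ 2 • a + (-inner ℝ a b : ℝ) • b = 0 := by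
    rw [← mul_star_mul_self, mul_star_eq_inner_add_cross, h, add_zero, smul_one_mul, neg_smul,
      add_neg_cancel]
  have hb : ‖b‖ ^ 2 = 0 := (LinearIndependent.pair_iff.1 hab _ _ hdep).1
  exact hab.ne_zero 1 (norm_eq_zero.1 (pow_eq_zero_iff two_ne_zero |>.1 hb))

theorem isImaginary_of_cross_eq_smul {a b c : CD n} {k : ℝ} (hk : k ≠ 0)
    (hcross : cross a b = k • c) : c.IsImaginary := by
  rw [← inv_smul_smul₀ hk c, ← hcross]
  exact (isImaginary_cross a b).smul _

theorem IsImaginary.mul_mul_of_norm_eq_one [IsAlternative (CD n)] {c : CD n} (hc : c.IsImaginary)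
    (hnorm : ‖c‖ = 1) (x : CD n) : c * (c * x) = -x := by
  rw [← neg_neg (c * _), ← neg_mul, ← hc.star_eq_neg, star_mul_mul, hnorm, one_pow, one_smul]

/-! ### Subalgebras and their orthogonal complements -/

theorem isSubalg_span {s : Set (CD n)} (hone : 1 ∈ Submodule.span ℝ s)
    (hmul : ∀ x ∈ s, ∀ y ∈ s, x * y ∈ Submodule.span ℝ s) : IsSubalg (Submodule.span ℝ s) where
  one_mem := hone
  mul_mem x hx y hy := LinearMap.BilinMap.apply_apply_mem_of_mem_span _ s s
    (LinearMap.mul ℝ (CD n)) hmul x y hx hy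
  star_mem x hx := by
    rw [star_eq_two_smul_sub]
    exact sub_mem (Submodule.smul_mem _ _ hone) hx

theorem mul_mem_swap {S : Submodule ℝ (CD n)} (hone : 1 ∈ S) {x y : CD n} (hx : x ∈ S) (hy : y ∈ S)
    (hxy : x * y ∈ S) : y * x ∈ S := by
  have h := mul_star_add_mul_star x y
  rw [star_eq_two_smul_sub x, star_eq_two_smul_sub y, mul_sub, mul_sub, mul_smul_one,
    mul_smul_one] at h
  have hyx : y * x = (2 * reCoord n y) • x - x * y + (2 * reCoord n x) • y -
      (2 * inner ℝ x y : ℝ) • (1 : CD n) := by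
    rw [← h]
    abel
  rw [hyx]
  exact sub_mem (add_mem (sub_mem (S.smul_mem _ hx) hxy) (S.smul_mem _ hy)) (S.smul_mem _ hone)

theorem mul_self_eq (x : CD n) : x * x = (2 * reCoord n x) • x - ‖x‖ ^ 2 • (1 : CD n) := by
  rw [← mul_star_self, star_eq_two_smul_sub, mul_sub, mul_smul_one, sub_sub_cancel]

theorem isSubalg_span_pair [IsAlternative (CD n)] (a b : CD n) :
    IsSubalg (Submodule.span ℝ {1, a, b, a * b}) := by
  set S := Submodule.span ℝ {1, a, b, a * b}
  have hone : 1 ∈ S := Submodule.subset_span (by simp)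
  have ha : a ∈ S := Submodule.subset_span (by simp)
  have hb : b ∈ S := Submodule.subset_span (by simp)
  have hab : a * b ∈ S := Submodule.subset_span (by simp)
  have mul_self_mem {x : CD n} (hx : x ∈ S) : x * x ∈ S := by
    rw [mul_self_eq]
    exact sub_mem (S.smul_mem _ hx) (S.smul_mem _ hone)
  have ha_ab : a * (a * b) ∈ S := by
    rw [← mul_self_mul, mul_self_eq, sub_mul, smul_mul_assoc, smul_one_mul]
    exact sub_mem (S.smul_mem _ hab) (S.smul_mem _ hb)
  have hab_b : a * b * b ∈ S := by
    rw [mul_mul_self, mul_self_eq, mul_sub, mul_smul_comm, mul_smul_one]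
    exact sub_mem (S.smul_mem _ hab) (S.smul_mem _ ha)
  have hba : b * a ∈ S := mul_mem_swap hone ha hb hab
  have hab_a : a * b * a ∈ S := mul_mem_swap hone ha hab ha_ab
  have hb_ab : b * (a * b) ∈ S := mul_mem_swap hone hab hb hab_b
  refine isSubalg_span hone ?_
  rintro _ (rfl | rfl | rfl | rfl) _ (rfl | rfl | rfl | rfl) <;>
    first
    | assumption
    | exact mul_self_mem ‹_›
    | simpa only [one_mul, mul_one]

theorem subset_generated (s : Set (CD n)) : s ⊆ generated s := fun _ hx =>
  Submodule.mem_sInf.2 fun _ hS => hS.2 hx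

theorem left_mem_generated_pair (a b : CD n) : a ∈ generated {a, b} :=
  subset_generated _ (Set.mem_insert _ _)

theorem right_mem_generated_pair (a b : CD n) : b ∈ generated {a, b} :=
  subset_generated _ (Set.mem_insert_of_mem _ rfl)

theorem generated_pair_eq_span [IsAlternative (CD n)] (a b : CD n) :
    generated {a, b} = Submodule.span ℝ {1, a, b, a * b} := by
  apply le_antisymm
  · refine sInf_le ⟨isSubalg_span_pair a b, ?_⟩
    rintro x (rfl | rfl) <;> exact Submodule.subset_span (by simp)
  · have hgen := isSubalg_generated {a, b}
    have ha := left_mem_generated_pair a b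
    have hb := right_mem_generated_pair a b
    rw [Submodule.span_le]
    rintro _ (rfl | rfl | rfl | rfl)
    exacts [hgen.one_mem, ha, hb, hgen.mul_mem _ ha _ hb]

theorem finrank_generated_pair_le [IsAlternative (CD n)] (a b : CD n) :
    Module.finrank ℝ (generated {a, b}) ≤ 4 := by
  classical
  have h := finrank_span_finset_le_card (R := ℝ) ({1, a, b, a * b} : Finset (CD n))
  push_cast at h
  rw [generated_pair_eq_span]
  exact h.trans Finset.card_le_four

namespace IsSubalg

variable {S : Submodule ℝ (CD n)} (hS : IsSubalg S)

include hS

theorem isImaginary_of_mem_orthogonal {x : CD n} (hx : x ∈ Sᗮ) : x.IsImaginary :=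
  isImaginary_iff_inner_one.2 (hx 1 hS.one_mem)

theorem mul_mem_orthogonal {p x : CD n} (hp : p ∈ S) (hx : x ∈ Sᗮ) : p * x ∈ Sᗮ := fun y hy => by
  rw [real_inner_comm, inner_mul_left_eq, real_inner_comm]
  exact hx _ (hS.mul_mem _ (hS.star_mem p hp) y hy)

theorem mul_eq_star_mul {p x : CD n} (hp : p ∈ S) (hx : x ∈ Sᗮ) : x * p = star p * x := by
  have h := mul_star_add_mul_star (star p) x
  rw [hx _ (hS.star_mem p hp), mul_zero, zero_smul ℝ (1 : CD n), star_star,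
    (hS.isImaginary_of_mem_orthogonal hx).star_eq_neg, mul_neg] at h
  exact (neg_add_eq_zero.1 h).symm

theorem mul_mul_of_mem_orthogonal [IsAlternative (CD n)] {p q x : CD n} (hp : p ∈ S) (hq : q ∈ S)
    (hx : x ∈ Sᗮ) : p * (q * x) = q * p * x := by
  have commute : associator q x p = q * (p * x) - p * (q * x) := by
    rw [associator, hS.mul_eq_star_mul hp hx, hS.mul_eq_star_mul hp (hS.mul_mem_orthogonal hq hx),
      star_eq_two_smul_sub]
    simp only [sub_mul, mul_sub, smul_mul_assoc, mul_smul_comm, one_mul]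
    abel
  rw [associator_swap_right, associator, neg_sub] at commute
  exact (sub_right_injective commute).symm

theorem cross_mem {a b : CD n} (ha : a ∈ S) (hb : b ∈ S) : cross a b ∈ S := by
  rw [← add_sub_cancel_left ((inner ℝ a b : ℝ) • (1 : CD n)) (cross a b),
    ← mul_star_eq_inner_add_cross]
  exact sub_mem (hS.mul_mem _ ha _ (hS.star_mem _ hb)) (S.smul_mem _ hS.one_mem)

end IsSubalg

theorem mem_generated_of_cross_eq_smul {a b c : CD n} {k : ℝ} (hk : k ≠ 0)
    (hcross : cross a b = k • c) : c ∈ generated {a, b} := by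
  rw [← inv_smul_smul₀ hk c, ← hcross]
  exact Submodule.smul_mem _ _ <| (isSubalg_generated _).cross_mem
    (left_mem_generated_pair a b) (right_mem_generated_pair a b)

/-! ### The operators `M u` -/

section Alternative

variable [IsAlternative (CD n)]

theorem associator_eq_zero_of_mem_generated {a b x : CD n} (hx : x ∈ generated {a, b}) :
    associator a x b = 0 := by
  rw [generated_pair_eq_span] at hx
  refine sub_eq_zero.2 (LinearMap.eqOn_span
    (f := LinearMap.mulRight ℝ b ∘ₗ LinearMap.mulLeft ℝ a)
    (g := LinearMap.mulLeft ℝ a ∘ₗ LinearMap.mulRight ℝ b) ?_ hx)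
  rintro _ (rfl | rfl | rfl | rfl)
  · change a * 1 * b = a * (1 * b)
    rw [mul_one, one_mul]
  · exact mul_self_mul _ _
  · exact mul_mul_self _ _
  · calc a * (a * b) * b = a * a * b * b := by rw [mul_self_mul]
      _ = a * (a * (b * b)) := by rw [mul_mul_self, mul_self_mul]
      _ = a * (a * b * b) := by rw [mul_mul_self]

theorem associator_of_mem_generated_orthogonal {a b x : CD n} (ha : a.IsImaginary)
    (hb : b.IsImaginary) (hx : x ∈ (generated {a, b})ᗮ) :
    associator a x b = (2 : ℝ) • (cross a b * x) := by
  rw [associator_swap_right, associator, neg_sub,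
    (isSubalg_generated _).mul_mul_of_mem_orthogonal (left_mem_generated_pair a b)
      (right_mem_generated_pair a b) hx, ← sub_mul, ← two_smul_cross ha hb, smul_mul_assoc]

theorem associator_eq_zero_of_not_linearIndependent {a b : CD n}
    (h : ¬LinearIndependent ℝ ![a, b]) (x : CD n) : associator a x b = 0 := by
  rcases eq_or_ne a 0 with rfl | ha
  · simp only [associator, zero_mul, sub_self]
  · obtain ⟨r, rfl⟩ : ∃ r : ℝ, r • a = b := by
      simpa only [LinearIndependent.pair_iff' ha, not_forall, not_not] using h
    rw [associator, mul_smul_comm, mul_smul_comm, mul_smul_comm, ← smul_sub, ← associator,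
      associator_flexible, smul_zero]

theorem M_apply {u : CD (n + 1)} (hu : u ≠ 0) (z : CD (n + 1)) :
    M u z = z + (1 / ‖u‖ ^ 2) •
      pair (associator u.fst z.snd u.snd) (-associator u.fst z.fst u.snd) := by
  change (1 / ‖u‖ ^ 2) • (star u * (u * z)) = _
  rw [star_mul_mul_succ, smul_add, smul_smul,
    one_div_mul_cancel (pow_ne_zero 2 (norm_ne_zero_iff.2 hu)), one_smul]

theorem M_eq_id_of_not_linearIndependent {u : CD (n + 1)} (hu : u ≠ 0)
    (h : ¬LinearIndependent ℝ ![u.fst, u.snd]) : M u = LinearMap.id := by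
  ext z : 1
  rw [M_apply hu, associator_eq_zero_of_not_linearIndependent h,
    associator_eq_zero_of_not_linearIndependent h, neg_zero,
    pair_zero_zero, smul_zero, add_zero, LinearMap.id_apply]

end Alternative

theorem M_smul {t : ℝ} (ht : t ≠ 0) (u : CD n) : M (t • u) = M u := by
  ext z : 1
  change (1 / ‖t • u‖ ^ 2) • (star (t • u) * (t • u * z)) = (1 / ‖u‖ ^ 2) • (star u * (u * z))
  rw [star_smul_real, smul_mul_assoc, smul_mul_assoc, mul_smul_comm, smul_smul, smul_smul,
    norm_smul, Real.norm_eq_abs, mul_pow, sq_abs]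
  congr 1
  field_simp

/-! ### Dimensions -/

/-- The identification of `A_{n+1}` with `A_n × A_n` as real vector spaces. -/
noncomputable def prodEquiv (n : ℕ) : CD (n + 1) ≃ₗ[ℝ] CD n × CD n where
  toFun x := (x.fst, x.snd)
  invFun p := pair p.1 p.2
  map_add' _ _ := rfl
  map_smul' _ _ := rfl

instance instFiniteDimensional : (n : ℕ) → FiniteDimensional ℝ (CD n)
  | 0 => inferInstanceAs (FiniteDimensional ℝ ℝ)
  | n + 1 =>
    haveI := instFiniteDimensional n
    (prodEquiv n).symm.finiteDimensional

theorem finrank_eq_two_pow : (n : ℕ) → Module.finrank ℝ (CD n) = 2 ^ n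
  | 0 => Module.finrank_self ℝ
  | n + 1 => by
    rw [(prodEquiv n).finrank_eq, Module.finrank_prod, finrank_eq_two_pow n, pow_succ, mul_two]

theorem generated_pair_orthogonal_ne_bot (a b : CD 3) : (generated {a, b})ᗮ ≠ ⊥ := by
  intro h
  have hdim := (generated {a, b}).finrank_add_finrank_orthogonal
  rw [h, finrank_bot, finrank_eq_two_pow] at hdim
  have hle := finrank_generated_pair_le a b
  omega

/-! ### The three eigenspaces -/

/-- The subspace `S × S` of `A_{n+1}`. -/
noncomputable def prodSubmodule (S : Submodule ℝ (CD n)) : Submodule ℝ (CD (n + 1)) :=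
  (S.prod S).comap (prodEquiv n).toLinearMap

/-- The subspace `{(x, c x) : x ∈ S}` of `A_{n+1}`, the graph over `S` of left multiplication
by `c`. -/
noncomputable def graphSubmodule (S : Submodule ℝ (CD n)) (c : CD n) : Submodule ℝ (CD (n + 1)) :=
  S.map ((prodEquiv n).symm.toLinearMap ∘ₗ LinearMap.id.prod (LinearMap.mulLeft ℝ c))

theorem mem_prodSubmodule {S : Submodule ℝ (CD n)} {z : CD (n + 1)} :
    z ∈ prodSubmodule S ↔ z.fst ∈ S ∧ z.snd ∈ S :=
  Iff.rfl

theorem mem_graphSubmodule {S : Submodule ℝ (CD n)} {c : CD n} {z : CD (n + 1)} :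
    z ∈ graphSubmodule S c ↔ ∃ x ∈ S, pair x (c * x) = z :=
  Iff.rfl

theorem coe_prodSubmodule (S : Submodule ℝ (CD n)) :
    (prodSubmodule S : Set (CD (n + 1))) = {z | ∃ x ∈ S, ∃ y ∈ S, z = pair x y} := by
  ext z
  constructor
  · exact fun hz => ⟨z.fst, hz.1, z.snd, hz.2, rfl⟩
  · rintro ⟨x, hx, y, hy, rfl⟩
    exact ⟨hx, hy⟩

theorem coe_graphSubmodule (S : Submodule ℝ (CD n)) (c : CD n) :
    (graphSubmodule S c : Set (CD (n + 1))) = {z | ∃ x ∈ S, z = pair x (c * x)} := by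
  ext z
  simp only [SetLike.mem_coe, mem_graphSubmodule, Set.mem_ofPred_eq, eq_comm (a := z)]

theorem prodSubmodule_ne_bot {S : Submodule ℝ (CD n)} (hS : S ≠ ⊥) : prodSubmodule S ≠ ⊥ := by
  obtain ⟨x, hx, hx0⟩ := S.exists_mem_ne_zero_of_ne_bot hS
  exact (Submodule.ne_bot_iff _).2 ⟨pair x x, ⟨hx, hx⟩, fun h => hx0 (congrArg fst h)⟩

theorem graphSubmodule_ne_bot {S : Submodule ℝ (CD n)} (hS : S ≠ ⊥) (c : CD n) :
    graphSubmodule S c ≠ ⊥ := by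
  obtain ⟨x, hx, hx0⟩ := S.exists_mem_ne_zero_of_ne_bot hS
  exact (Submodule.ne_bot_iff _).2
    ⟨pair x (c * x), mem_graphSubmodule.2 ⟨x, hx, rfl⟩, fun h => hx0 (congrArg fst h)⟩

theorem IsSubalg.graphSubmodule_top_le {S : Submodule ℝ (CD n)} (hS : IsSubalg S) {c : CD n}
    (hc : c ∈ S) : graphSubmodule ⊤ c ≤ prodSubmodule S ⊔ graphSubmodule Sᗮ c := by
  rintro _ ⟨x, -, rfl⟩
  have hx : x ∈ S ⊔ Sᗮ := by
    rw [Submodule.sup_orthogonal_of_hasOrthogonalProjection]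
    trivial
  obtain ⟨p, hp, q, hq, rfl⟩ := Submodule.mem_sup.1 hx
  rw [map_add]
  exact Submodule.add_mem_sup ⟨hp, hS.mul_mem _ hc _ hp⟩ ⟨q, hq, rfl⟩

section Alternative

variable [IsAlternative (CD n)]

theorem graphSubmodule_neg_sup_graphSubmodule {c : CD n} (hc : c.IsImaginary) (hnorm : ‖c‖ = 1) :
    graphSubmodule ⊤ (-c) ⊔ graphSubmodule ⊤ c = ⊤ := by
  refine eq_top_iff.2 fun z _ => Submodule.mem_sup.2 ?_
  refine ⟨_, ⟨(1 / 2 : ℝ) • (z.fst + c * z.snd), trivial, rfl⟩,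
    _, ⟨(1 / 2 : ℝ) • (z.fst - c * z.snd), trivial, rfl⟩, ext ?_ ?_⟩
  · change (1 / 2 : ℝ) • (z.fst + c * z.snd) + (1 / 2 : ℝ) • (z.fst - c * z.snd) = z.fst
    module
  · change -c * ((1 / 2 : ℝ) • (z.fst + c * z.snd)) + c * ((1 / 2 : ℝ) • (z.fst - c * z.snd)) =
      z.snd
    rw [mul_smul_comm, mul_smul_comm, mul_add, mul_sub, neg_mul, neg_mul,
      hc.mul_mul_of_norm_eq_one hnorm]
    module

theorem prodSubmodule_generated_le_eig {a b : CD n} (h : pair a b ≠ 0) :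
    prodSubmodule (generated {a, b}) ≤ Eig 1 (pair a b) := by
  intro z hz
  obtain ⟨hfst, hsnd⟩ := mem_prodSubmodule.1 hz
  refine Module.End.mem_eigenspace_iff.2 ?_
  rw [M_apply h, fst_pair, snd_pair, associator_eq_zero_of_mem_generated hfst,
    associator_eq_zero_of_mem_generated hsnd, neg_zero, pair_zero_zero, smul_zero, add_zero,
    one_smul]

theorem graphSubmodule_generated_orthogonal_le_eig {a b c : CD n} {k : ℝ} (ha : a.IsImaginary)
    (hb : b.IsImaginary) (hab : ‖pair a b‖ = 1) (hc : c.IsImaginary) (hnorm : ‖c‖ = 1)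
    (hc_mem : c ∈ generated {a, b}) (hcross : cross a b = k • c) :
    graphSubmodule (generated {a, b})ᗮ c ≤ Eig (1 - 2 * k) (pair a b) := by
  rintro _ ⟨x, hx, rfl⟩
  have hcx := (isSubalg_generated {a, b}).mul_mem_orthogonal hc_mem hx
  have hpair : pair a b ≠ 0 := norm_ne_zero_iff.1 (hab ▸ one_ne_zero)
  refine Module.End.mem_eigenspace_iff.2 ?_
  change M (pair a b) (pair x (c * x)) = (1 - 2 * k) • pair x (c * x)
  rw [M_apply hpair, hab, fst_pair, snd_pair, fst_pair, snd_pair,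
    associator_of_mem_generated_orthogonal ha hb hx,
    associator_of_mem_generated_orthogonal ha hb hcx, hcross, smul_mul_assoc, smul_mul_assoc,
    hc.mul_mul_of_norm_eq_one hnorm, one_pow, div_one]
  apply ext
  · simp only [fst_add, fst_smul, fst_pair]
    module
  · simp only [snd_add, snd_smul, snd_pair]
    module

theorem IsSubalg.iSup_prodSubmodule_graphSubmodule {S : Submodule ℝ (CD n)} (hS : IsSubalg S)
    {c : CD n} (hc_mem : c ∈ S) (hc : c.IsImaginary) (hnorm : ‖c‖ = 1) :
    ⨆ i, ![prodSubmodule S, graphSubmodule Sᗮ (-c), graphSubmodule Sᗮ c] i = ⊤ := by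
  have hneg := hS.graphSubmodule_top_le (neg_mem hc_mem)
  have hpos := hS.graphSubmodule_top_le hc_mem
  rw [iSup_fin_three, eq_top_iff, ← graphSubmodule_neg_sup_graphSubmodule hc hnorm]
  exact sup_le (hneg.trans le_sup_left)
    (hpos.trans (sup_le (le_sup_left.trans le_sup_left) le_sup_right))

theorem eigenvalues_injective {k : ℝ} (hk : k ≠ 0) :
    Function.Injective ![1, 1 + 2 * k, 1 - 2 * k] := by
  have hsub : 1 ≠ 1 - 2 * k := fun h => hk (by linarith)
  have hadd_sub : 1 + 2 * k ≠ 1 - 2 * k := fun h => hk (by linarith)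
  refine Fin.cons_injective_iff.2
    ⟨?_, Fin.cons_injective_iff.2 ⟨?_, Function.injective_of_subsingleton _⟩⟩
  · simp [hk, hsub]
  · simpa using hadd_sub

section Eigentheory

variable {a b c : CD n} {k : ℝ} (ha : a.IsImaginary) (hb : b.IsImaginary) (hab : ‖pair a b‖ = 1)
  (hnorm : ‖c‖ = 1) (hk : k ≠ 0) (hcross : cross a b = k • c)

include hnorm hk hcross

theorem iSup_prodSubmodule_graphSubmodule_generated :
    ⨆ i, ![prodSubmodule (generated {a, b}), graphSubmodule (generated {a, b})ᗮ (-c),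
      graphSubmodule (generated {a, b})ᗮ c] i = ⊤ :=
  (isSubalg_generated _).iSup_prodSubmodule_graphSubmodule
    (mem_generated_of_cross_eq_smul hk hcross) (isImaginary_of_cross_eq_smul hk hcross) hnorm

include ha hb hab

theorem eig_comp_eq :
    (Eig · (pair a b)) ∘ ![1, 1 + 2 * k, 1 - 2 * k] =
      ![prodSubmodule (generated {a, b}), graphSubmodule (generated {a, b})ᗮ (-c),
        graphSubmodule (generated {a, b})ᗮ c] := by
  have hc := isImaginary_of_cross_eq_smul hk hcross
  have hc_mem := mem_generated_of_cross_eq_smul hk hcross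
  have hprod := prodSubmodule_generated_le_eig (norm_ne_zero_iff.1 (hab ▸ one_ne_zero))
  have hpos := graphSubmodule_generated_orthogonal_le_eig ha hb hab hc hnorm hc_mem hcross
  have hneg := graphSubmodule_generated_orthogonal_le_eig (c := -c) (k := -k) ha hb hab
    (neg_one_smul ℝ c ▸ hc.smul (-1)) (by rw [norm_neg, hnorm]) (neg_mem hc_mem)
    (by rw [neg_smul_neg, hcross])
  rw [mul_neg, sub_neg_eq_add] at hneg
  have hindep := (M (pair a b)).eigenspaces_iSupIndep.comp (eigenvalues_injective hk)
  refine ((hindep.le_iff_eq_of_iSup_eq_top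
    (iSup_prodSubmodule_graphSubmodule_generated hnorm hk hcross)).1 fun i => ?_).symm
  fin_cases i
  exacts [hprod, hneg, hpos]

theorem iSup_eig_eq_top : ⨆ i, Eig (![1, 1 + 2 * k, 1 - 2 * k] i) (pair a b) = ⊤ :=
  (iSup_congr (congrFun (eig_comp_eq ha hb hab hnorm hk hcross))).trans
    (iSup_prodSubmodule_graphSubmodule_generated hnorm hk hcross)

theorem eig_one_eq : Eig 1 (pair a b) = prodSubmodule (generated {a, b}) :=
  congrFun (eig_comp_eq ha hb hab hnorm hk hcross) 0

theorem eig_one_add_eq :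
    Eig (1 + 2 * k) (pair a b) = graphSubmodule (generated {a, b})ᗮ (-c) :=
  congrFun (eig_comp_eq ha hb hab hnorm hk hcross) 1

theorem eig_one_sub_eq : Eig (1 - 2 * k) (pair a b) = graphSubmodule (generated {a, b})ᗮ c :=
  congrFun (eig_comp_eq ha hb hab hnorm hk hcross) 2

theorem isInternal_eig :
    DirectSum.IsInternal ![Eig 1 (pair a b), Eig (1 + 2 * k) (pair a b),
      Eig (1 - 2 * k) (pair a b)] := by
  have hfamily : ![Eig 1 (pair a b), Eig (1 + 2 * k) (pair a b), Eig (1 - 2 * k) (pair a b)] =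
      (Eig · (pair a b)) ∘ ![1, 1 + 2 * k, 1 - 2 * k] := by
    funext i
    fin_cases i <;> rfl
  rw [hfamily]
  exact DirectSum.isInternal_submodule_of_iSupIndep_of_iSup_eq_top
    ((M (pair a b)).eigenspaces_iSupIndep.comp (eigenvalues_injective hk))
    (iSup_eig_eq_top ha hb hab hnorm hk hcross)

theorem hasEigenvalue_iff (hne : (generated {a, b})ᗮ ≠ ⊥) (r : ℝ) :
    Module.End.HasEigenvalue (M (pair a b)) r ↔ r = 1 ∨ r = 1 + 2 * k ∨ r = 1 - 2 * k := by
  rw [Module.End.hasEigenvalue_iff]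
  constructor
  · intro hr
    have htop : ⨆ s ∈ Set.range ![1, 1 + 2 * k, 1 - 2 * k], Eig s (pair a b) = ⊤ := by
      rw [iSup_range, iSup_eig_eq_top ha hb hab hnorm hk hcross]
    simpa [or_assoc, or_comm] using
      (M (pair a b)).eigenspaces_iSupIndep.mem_of_biSup_eq_top htop hr
  · have hone : generated {a, b} ≠ ⊥ :=
      (Submodule.ne_bot_iff _).2 ⟨1, (isSubalg_generated _).one_mem, one_ne_zero⟩
    rintro (rfl | rfl | rfl)
    · exact (eig_one_eq ha hb hab hnorm hk hcross).trans_ne (prodSubmodule_ne_bot hone)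
    · exact (eig_one_add_eq ha hb hab hnorm hk hcross).trans_ne (graphSubmodule_ne_bot hne _)
    · exact (eig_one_sub_eq ha hb hab hnorm hk hcross).trans_ne (graphSubmodule_ne_bot hne _)

end Eigentheory

end Alternative

/-! ### Elements orthogonal to the complex line -/

theorem isImaginary_fst_and_snd {u : CD (n + 1)} (hu : u ∈ (complexLine n)ᗮ) :
    u.fst.IsImaginary ∧ u.snd.IsImaginary := by
  have hone : inner ℝ 1 u = 0 := hu 1 (Submodule.subset_span (by simp))
  have hi : inner ℝ (iElt n) u = 0 := hu _ (Submodule.subset_span (by simp))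
  rw [inner_def, reCoord_mul_star, iElt, fst_pair, snd_pair, zero_mul, reCoord_zero,
    zero_add, ← inner_def] at hi
  have hre := isImaginary_iff_reCoord_eq_zero.1 (isImaginary_iff_inner_one.2 hone)
  exact ⟨isImaginary_iff_reCoord_eq_zero.2 hre, isImaginary_iff_inner_one.2 hi⟩

theorem exists_eq_smul_pair {u : CD (n + 1)} (hu : u ≠ 0) (hperp : u ∈ (complexLine n)ᗮ) :
    ∃ (t : ℝ) (a b : CD n), 0 < t ∧ a.IsImaginary ∧ b.IsImaginary ∧ ‖a‖ ^ 2 + ‖b‖ ^ 2 = 1 ∧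
      u = t • pair a b := by
  have ht : ‖u‖ ≠ 0 := norm_ne_zero_iff.2 hu
  obtain ⟨ha, hb⟩ := isImaginary_fst_and_snd hperp
  refine ⟨‖u‖, ‖u‖⁻¹ • u.fst, ‖u‖⁻¹ • u.snd, norm_pos_iff.2 hu, ha.smul _, hb.smul _, ?_,
    (smul_inv_smul₀ ht u).symm⟩
  rw [← fst_smul, ← snd_smul, ← norm_sq_eq_add, norm_smul, norm_inv, norm_norm,
    inv_mul_cancel₀ ht, one_pow]

end CD

theorem mainTheorem5 :
    -- the unit elements `(a, b)` with `a`, `b` imaginary and linearly independent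
    (∀ a b : CD 3, a.IsImaginary → b.IsImaginary → LinearIndependent ℝ ![a, b] →
      ‖a‖ ^ 2 + ‖b‖ ^ 2 = 1 →
      ∀ c : CD 3, c = (1 / ‖CD.cross a b‖) • CD.cross a b →
        -- `(a, b)` is a unit vector, and `c` is well defined
        ‖CD.pair a b‖ = 1 ∧ CD.cross a b ≠ 0 ∧
        -- the three eigenspaces
        (CD.Eig 1 (CD.pair a b) : Set (CD 4)) =
          {z | ∃ x ∈ CD.generated {a, b}, ∃ y ∈ CD.generated {a, b}, z = CD.pair x y} ∧
        (CD.Eig (1 + 2 * ‖CD.cross a b‖) (CD.pair a b) : Set (CD 4)) =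
          {z | ∃ x ∈ (CD.generated {a, b})ᗮ, z = CD.pair x (-(c * x))} ∧
        (CD.Eig (1 - 2 * ‖CD.cross a b‖) (CD.pair a b) : Set (CD 4)) =
          {z | ∃ x ∈ (CD.generated {a, b})ᗮ, z = CD.pair x (c * x)} ∧
        -- their direct sum is the whole algebra, and there are no other eigenvalues
        DirectSum.IsInternal ![CD.Eig 1 (CD.pair a b),
          CD.Eig (1 + 2 * ‖CD.cross a b‖) (CD.pair a b),
          CD.Eig (1 - 2 * ‖CD.cross a b‖) (CD.pair a b)] ∧
        (∀ r : ℝ, Module.End.HasEigenvalue (CD.M (CD.pair a b)) r ↔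
          r = 1 ∨ r = 1 + 2 * ‖CD.cross a b‖ ∨ r = 1 - 2 * ‖CD.cross a b‖)) ∧
    -- every non-zero element orthogonal to `ℂ_4` is, up to a positive real scalar, which does not
    -- change the eigentheory, such an `(a, b)` or has linearly dependent components, and in the
    -- latter case its operator is the identity
    (∀ u : CD 4, u ≠ 0 → u ∈ (CD.complexLine 3)ᗮ →
      ∃ (t : ℝ) (a b : CD 3), 0 < t ∧ a.IsImaginary ∧ b.IsImaginary ∧ ‖a‖ ^ 2 + ‖b‖ ^ 2 = 1 ∧
        u = t • CD.pair a b ∧ CD.M u = CD.M (CD.pair a b) ∧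
        (¬ LinearIndependent ℝ ![a, b] → CD.M u = LinearMap.id)) := by
  refine ⟨fun a b ha hb hlin hnorm c hc => ?_, fun u hu hperp => ?_⟩
  · have hunit := CD.norm_pair_eq_one hnorm
    have hcross_ne := CD.cross_ne_zero hlin
    have hk : ‖CD.cross a b‖ ≠ 0 := norm_ne_zero_iff.2 hcross_ne
    have hc_norm : ‖c‖ = 1 := by
      rw [hc, one_div, norm_smul, norm_inv, norm_norm, inv_mul_cancel₀ hk]
    have hcross : CD.cross a b = ‖CD.cross a b‖ • c := by rw [hc, one_div, smul_inv_smul₀ hk]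
    refine ⟨hunit, hcross_ne, ?_, ?_, ?_, CD.isInternal_eig ha hb hunit hc_norm hk hcross,
      CD.hasEigenvalue_iff ha hb hunit hc_norm hk hcross (CD.generated_pair_orthogonal_ne_bot a b)⟩
    · rw [CD.eig_one_eq ha hb hunit hc_norm hk hcross, CD.coe_prodSubmodule]
    · rw [CD.eig_one_add_eq ha hb hunit hc_norm hk hcross, CD.coe_graphSubmodule]
      simp only [neg_mul]
    · rw [CD.eig_one_sub_eq ha hb hunit hc_norm hk hcross, CD.coe_graphSubmodule]
  · obtain ⟨t, a, b, ht, ha, hb, hnorm, rfl⟩ := CD.exists_eq_smul_pair hu hperp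
    have hM := CD.M_smul ht.ne' (CD.pair a b)
    have hpair : CD.pair a b ≠ 0 := right_ne_zero_of_smul hu
    exact ⟨t, a, b, ht, ha, hb, hnorm, rfl, hM, fun hdep =>
      hM.trans (CD.M_eq_id_of_not_linearIndependent hpair hdep)⟩
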